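/- **Theorem (Noise robustness).** Let $\mathbb T=\mathbb R/\mathbb Z$, let $\mathcal M(\mathbb T)$ be the space of real Radon measures on $\mathbb T$ (the dual of $C(\mathbb T)$) with the total variation norm $\|\cdot\|_{TV}$, let $\varphi\in C^2(\mathbb T,\mathbb R)$, and let $$\Phi:\mathcal M(\mathbb T)\to L^2(\mathbb T),\quad (\Phi m)(t)=\int_{\mathbb T}\varphi(x-t)\,dm(x),\qquad \Phi^*:L^2(\mathbb T)\to C(\mathbb T),\quad (\Phi^*p)(t)=\int_{\mathbb T}\varphi(t-x)p(x)\,dx .$$ For $z\in L^2(\mathbb T)$ let $\mathcal P_\lambda(z)$, $\lambda>0$, be the problem of minimizing $\frac12\|\Phi m-z\|_2^2+\lambda\|m\|_{TV}$ over $m\in\mathcal M(\mathbb T)$, and let $\mathcal P_0(z)$ be the problem of minimizing $\|m\|_{TV}$ subject to $\Phi m=z$. Let $m_0=\sum_{i=1}^N a_{0,i}\delta_{x_{0,i}}$ with all $a_{0,i}\in\mathbb R\setminus\{0\}$ and $x_{0,1},\dots,x_{0,N}\in\mathbb T$ distinct, and put $y=\Phi m_0$. Assume: 1. the map $\Gamma_{x_0}:\mathbb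 R^N\times\mathbb R^N\to L^2(\mathbb T)$, $(u,v)\mapsto\sum_{i=1}^N\big(u_i\,\varphi(x_{0,i}-\cdot)+v_i\,\varphi'(x_{0,i}-\cdot)\big)$, is injective; 2. $m_0$ satisfies the Non Degenerate Source Condition: there is $p\in L^2(\mathbb T)$ with $\Phi^*p\in\partial\|m_0\|_{TV}$, that is, $\|m\|_{TV}\ge\|m_0\|_{TV}+\int\Phi^*p\,d(m-m_0)$ for all $m\in\mathcal M(\mathbb T)$; and $\eta_0=\Phi^*p_0$, where $p_0$ is the solution of minimal $L^2$ norm of $\sup\{\langle y,p\rangle:\|\Phi^*p\|_\infty\le1\}$, satisfies $|\eta_0(s)|<1$ for all $s\in\mathbb T\setminus\{x_{0,1},\dots,x_{0,N}\}$ and $\eta_0''(x_{0,i})\ne0$ for $i=1,\dots,N$. Then there are $\alpha>0$ and $\lambda_0>0$ such that, with $D_{\alpha,\lambda_0}=\{(\lambda,w)\in\mathbb R\times L^2(\mathbb T): 0\le\lambda\le\lambda_0,\ \|w\|_2\le\alpha\lambda\}$, the following hold. * For every $(\lambda,w)\in D_{\alpha,\lambda_0}$ the problem $\mathcal P_\lambda(y+w)$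 has exactly one solution, and it is composed of exactly $N$ spikes: it equals $\sum_{i=1}^N\tilde a_i(\lambda,w)\,\delta_{\tilde x_i(\lambda,w)}$ with distinct positions, $\tilde a_i(\lambda,w)\neq0$ and $\operatorname{sign}\tilde a_i(\lambda,w)=\operatorname{sign}a_{0,i}$ for all $i$. Moreover $(\tilde a,\tilde x)(0,0)=(a_0,x_0)$. * For every integer $k\ge2$ such that $\varphi\in C^k(\mathbb T)$, the map $(\lambda,w)\in D_{\alpha,\lambda_0}\mapsto(\tilde a(\lambda,w),\tilde x(\lambda,w))\in\mathbb R^N\times\mathbb T^N$ is of class $C^{k-1}$, in the sense that it is the restriction of a $C^{k-1}$ map on an open neighbourhood of $D_{\alpha,\lambda_0}$ in $\mathbb R\times L^2(\mathbb T)$. * There is a constant $C$ such that for every $w\in L^2(\mathbb T)$ with $\|w\|_2\le\alpha\lambda_0$, taking $\lambda=\|w\|_2/\alpha$, one has $|\tilde x_i(\lambda,w)-x_{0,i}|\le C\|w\|_2$ (distance on $\mathbb T$) and $|\tilde a_i(\lambda,w)-a_{0,i}|\le C\|w\|_2$ for all $i$. -/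

import Mathlib

open MeasureTheory Filter Topology

noncomputable section

namespace SpikeDeconv

/-- The torus `𝕋 = ℝ/ℤ`, with its Lebesgue (Haar) measure `volume` of total mass one. -/
abbrev Torus : Type := UnitAddCircle

/-- The real Hilbert space `L²(𝕋)`. -/
abbrev L2 : Type := Lp ℝ 2 (volume : Measure Torus)

/-- The real Radon measures on `𝕋`, as the dual of `C(𝕋)`. The dual norm `‖m‖` is the
total variation of `m`, and `∫ ψ dm` is written `m ψ`. -/
abbrev Radon : Type := C(Torus, ℝ) →L[ℝ] ℝ

/-- The discrete measure `m_{a,x} = ∑ i, a i • δ_{x i}`. -/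
def discreteMeasure {N : ℕ} (a : Fin N → ℝ) (x : Fin N → Torus) : Radon :=
  ∑ i, a i • ContinuousMap.evalCLM ℝ (x i)

/-- `f : 𝕋 → ℝ` is of class `C^n`: its `1`-periodic lift to `ℝ` is. -/
def IsC (n : WithTop ℕ∞) (f : Torus → ℝ) : Prop :=
  ContDiff ℝ n (fun s : ℝ => f (s : Torus))

/-- The derivative of a function on the torus. -/
def torusDeriv (f : Torus → ℝ) (t : Torus) : ℝ :=
  deriv (fun s : ℝ => f (t + (s : Torus))) 0

theorem continuous_torusDeriv {f : Torus → ℝ} (hf : IsC 1 f) : Continuous (torusDeriv f) := by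
  have h : Continuous (fun s : ℝ => torusDeriv f (s : Torus)) := by
    have e : (fun s : ℝ => torusDeriv f (s : Torus)) =
        deriv (fun s : ℝ => f (s : Torus)) := by
      funext s
      have := deriv_comp_const_add (fun r : ℝ => f (r : Torus)) s 0
      simpa [torusDeriv] using this
    rw [e]
    exact hf.continuous_deriv le_rfl
  exact continuous_coinduced_dom.2 h

/-- The derivative `φ'`, as a continuous function, of a function `φ` of class `C²`. -/
def derivC (φ : C(Torus, ℝ)) (hφ : IsC 2 φ) : C(Torus, ℝ) :=
  ⟨torusDeriv φ, continuous_torusDeriv (ContDiff.of_le hφ (by norm_num))⟩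

/-- The continuous map `t ↦ φ(· - t)` from `𝕋` to `C(𝕋)`. -/
def shift (φ : C(Torus, ℝ)) : C(Torus, C(Torus, ℝ)) :=
  ContinuousMap.curry ⟨fun q : Torus × Torus => φ (q.2 - q.1), by fun_prop⟩

/-- The operator `Φ : M(𝕋) → L²(𝕋)` with kernel `φ`, `(Φ m)(t) = ∫ φ(x - t) dm(x)`. -/
def Phi (φ : C(Torus, ℝ)) (m : Radon) : L2 :=
  ContinuousMap.toLp 2 volume ℝ ⟨fun t => m (shift φ t), by fun_prop⟩

theorem continuous_conv (φ : C(Torus, ℝ)) (p : L2) :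
    Continuous fun t : Torus => ∫ x, φ (t - x) * p x := by
  have hp : Integrable (p : Torus → ℝ) volume :=
    (Lp.memLp p).integrable (by norm_num)
  refine continuous_of_dominated (bound := fun x => ‖φ‖ * ‖p x‖) ?_ ?_ ?_ ?_
  · intro t
    exact (by fun_prop : Continuous fun x : Torus => φ (t - x)).aestronglyMeasurable.mul
      hp.aestronglyMeasurable
  · intro t
    filter_upwards with x
    rw [norm_mul]
    gcongr
    exact φ.norm_coe_le_norm _
  · exact hp.norm.const_mul _
  · filter_upwards with x
    fun_prop

/-- The adjoint `Φ* : L²(𝕋) → C(𝕋)`, `(Φ* p)(t) = ∫ φ(t - x) p(x) dx`. -/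
def PhiAdj (φ : C(Torus, ℝ)) (p : L2) : C(Torus, ℝ) :=
  ⟨fun t => ∫ x, φ (t - x) * p x, continuous_conv φ p⟩

/-- `Γ_x (u, v) = Φ_x u + Φ'_x v = ∑ i, (u i • φ(x i - ·) + v i • φ'(x i - ·)) ∈ L²(𝕋)`. -/
def Gam (φ : C(Torus, ℝ)) (hφ : IsC 2 φ) {N : ℕ} (x : Fin N → Torus)
    (q : (Fin N → ℝ) × (Fin N → ℝ)) : L2 :=
  Phi φ (discreteMeasure q.1 x) + Phi (derivC φ hφ) (discreteMeasure q.2 x)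

/-- The subdifferential of the total variation at `m`. -/
def subdiffTV (m : Radon) : Set C(Torus, ℝ) :=
  {η | ∀ m' : Radon, ‖m‖ + (m' - m) η ≤ ‖m'‖}

/-- `m` solves `P_lam(z)`: for `lam ≠ 0`, minimize `½‖Φ m - z‖² + lam ‖m‖` over all measures;
for `lam = 0`, minimize `‖m‖` subject to `Φ m = z`. -/
def IsPrimalSolution (φ : C(Torus, ℝ)) (lam : ℝ) (z : L2) (m : Radon) : Prop :=
  (lam ≠ 0 → ∀ m' : Radon,
    1 / 2 * ‖Phi φ m - z‖ ^ 2 + lam * ‖m‖ ≤ 1 / 2 * ‖Phi φ m' - z‖ ^ 2 + lam * ‖m'‖) ∧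
  (lam = 0 → Phi φ m = z ∧ ∀ m' : Radon, Phi φ m' = z → ‖m‖ ≤ ‖m'‖)

/-- `p` solves `D_0(y)`: maximize `⟪y, p⟫` subject to `‖Φ* p‖_∞ ≤ 1`. -/
def IsDualSolution (φ : C(Torus, ℝ)) (y p : L2) : Prop :=
  ‖PhiAdj φ p‖ ≤ 1 ∧ ∀ q : L2, ‖PhiAdj φ q‖ ≤ 1 → inner ℝ y q ≤ inner ℝ y p

/-- `p` is the solution of `D_0(y)` of minimal norm. -/
def IsMinNormDualSolution (φ : C(Torus, ℝ)) (y p : L2) : Prop :=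
  IsDualSolution φ y p ∧ ∀ q : L2, IsDualSolution φ y q → ‖p‖ ≤ ‖q‖

/-- The Non Degenerate Source Condition for `m_{a,x}` (with `a i ≠ 0` and distinct `x i`). -/
def NDSC (φ : C(Torus, ℝ)) {N : ℕ} (a : Fin N → ℝ) (x : Fin N → Torus) : Prop :=
  (∃ p : L2, PhiAdj φ p ∈ subdiffTV (discreteMeasure a x)) ∧
  ∃ p₀ : L2, IsMinNormDualSolution φ (Phi φ (discreteMeasure a x)) p₀ ∧
    (∀ s : Torus, s ∉ Set.range x → |PhiAdj φ p₀ s| < 1) ∧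
    ∀ i, torusDeriv (torusDeriv (PhiAdj φ p₀)) (x i) ≠ 0

/-- The small noise domain `D_{α,lam0}`. -/
def smallNoise (α lam0 : ℝ) : Set (ℝ × L2) :=
  {q | 0 ≤ q.1 ∧ q.1 ≤ lam0 ∧ ‖q.2‖ ≤ α * q.1}

/-- A map `g` into `𝕋^N` is of class `C^n` on `U`: near each point of `U` it is the projection of
an `ℝ^N`-valued map of class `C^n`. -/
def TorusContDiffOn {E : Type*} [NormedAddCommGroup E] [NormedSpace ℝ E] {N : ℕ}
    (n : WithTop ℕ∞) (g : E → Fin N → Torus) (U : Set E) : Prop :=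
  ∀ q ∈ U, ∃ X : E → Fin N → ℝ, ContDiffWithinAt ℝ n X U q ∧
    ∀ᶠ r in 𝓝[U] q, ∀ i, g r i = ((X r i : ℝ) : Torus)

end SpikeDeconv

end

open SpikeDeconv

/-!
Since `‖·‖_{TV}` is the dual norm on `C(𝕋)`, a sum of distinct spikes `∑ aᵢ δ_{xᵢ}` solves
`𝒫_λ(z)` as soon as the dual variable `p = (z - Φ m) / λ` satisfies `(Φ* p)(xᵢ) = sign aᵢ` and
`‖Φ* p‖_∞ ≤ 1`; it is the only solution if moreover `|Φ* p| < 1` off the spikes and `Φ` is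
injective on measures supported by the spikes.

The interpolation conditions `Φ* p (xᵢ) = sign aᵢ`, `(Φ* p)' (xᵢ) = 0`, multiplied by `λ`, form a
system in `(a, x)` that still makes sense at `λ = 0`, where it is solved by `(a₀, x₀)` with an
invertible Jacobian, essentially the Gram matrix of `Γ_{x₀}`. The implicit function theorem
gives a smooth branch `(a, x)` of solutions near `(λ, w) = (0, 0)`.

Along this branch the dual variable must stay close to `p₀`. Minimality of the norm and the
nondegeneracy of `η₀` force `p₀` into the range of `Γ_{x₀}`. To first order at `(0, 0)`,
`p - p₀` is then orthogonal to this range and lies in it up to `w / λ`, so its norm is at most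
`‖w‖ / λ ≤ α`. Nondegeneracy of a certificate is an open condition, by strict concavity near the
spikes and compactness away from them, so for small `α` the branch satisfies the optimality
conditions above.
-/

noncomputable section

namespace SpikeDeconv

section Duality

theorem apply_le_norm {E : Type*} [SeminormedAddCommGroup E] [NormedSpace ℝ E] (m : E →L[ℝ] ℝ)
    {e : E} (he : ‖e‖ ≤ 1) : m e ≤ ‖m‖ :=
  (le_abs_self _).trans (m.le_of_opNorm_le_of_le le_rfl he |>.trans_eq (mul_one _))

variable {X : Type*} [TopologicalSpace X] [CompactSpace X]

theorem norm_evalCLM_le (t : X) : ‖(ContinuousMap.evalCLM ℝ t : C(X, ℝ) →L[ℝ] ℝ)‖ ≤ 1 :=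
  ContinuousLinearMap.opNorm_le_bound _ zero_le_one fun f =>
    (f.norm_coe_le_norm t).trans_eq (one_mul _).symm

theorem exists_abs_le_add_mul {f g : X → ℝ} (hf : Continuous f) (hg : Continuous g)
    (hg_nonneg : ∀ t, 0 ≤ g t) (hfg : ∀ t, f t ≠ 0 → 0 < g t) {ε : ℝ} (hε : 0 < ε) :
    ∃ C > 0, ∀ t, |f t| ≤ ε + C * g t := by
  have hK : IsCompact {t | ε ≤ |f t|} := (isClosed_le continuous_const hf.abs).isCompact
  have hpos : ∀ t ∈ {t | ε ≤ |f t|}, 0 < g t := fun t ht => hfg t (abs_pos.1 (hε.trans_le ht))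
  obtain ⟨C, hC⟩ := hK.bddAbove_image (f := fun t => |f t| / g t)
    (hf.abs.continuousOn.div hg.continuousOn fun t ht => (hpos t ht).ne')
  refine ⟨max C 1, by positivity, fun t => ?_⟩
  rcases le_total |f t| ε with ht | ht
  · have := hg_nonneg t
    exact ht.trans (le_add_of_nonneg_right (by positivity))
  · have hratio : |f t| / g t ≤ max C 1 := (hC ⟨t, ht, rfl⟩).trans (le_max_left _ _)
    have := (div_le_iff₀ (hpos t ht)).1 hratio
    linarith

section NormAttained

variable {m : C(X, ℝ) →L[ℝ] ℝ} {η : C(X, ℝ)}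

/- A perturbation `η + f / C` raises the sup norm by at most `ε / C`, so `m f ≤ ε ‖m‖`. -/
theorem apply_nonpos_of_norm_attained (hm : m η = ‖m‖) (hη : ‖η‖ ≤ 1) {f : C(X, ℝ)}
    (hf : ∀ t, f t ≠ 0 → |η t| < 1) : m f ≤ 0 := by
  have hη' : ∀ t, |η t| ≤ 1 := fun t => (η.norm_coe_le_norm t).trans hη
  suffices h : ∀ ε > 0, m f ≤ ε * ‖m‖ from
    ge_of_tendsto (x := 𝓝[>] 0) (((continuous_mul_const ‖m‖).tendsto' 0 0 (zero_mul _)).mono_left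
      nhdsWithin_le_nhds) (eventually_mem_nhdsWithin.mono h)
  intro ε hε
  obtain ⟨C, hC, hfC⟩ := exists_abs_le_add_mul f.continuous
    (continuous_const.sub η.continuous.abs) (fun t => sub_nonneg.2 (hη' t))
    (fun t ht => sub_pos.2 (hf t ht)) hε
  have hpert : ‖C • η + f‖ ≤ C + ε := by
    refine (ContinuousMap.norm_le _ (by positivity)).2 fun t => ?_
    calc |C * η t + f t| ≤ C * |η t| + |f t| := by
          simpa [abs_mul, abs_of_pos hC] using abs_add_le (C * η t) (f t)
      _ ≤ C * |η t| + (ε + C * (1 - |η t|)) := by gcongr; exact hfC t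
      _ = C + ε := by ring
  have happly : C * ‖m‖ + m f ≤ ‖m‖ * (C + ε) := by
    simpa [hm] using (le_abs_self _).trans (m.le_of_opNorm_le_of_le le_rfl hpert)
  linarith

theorem apply_eq_zero_of_norm_attained (hm : m η = ‖m‖) (hη : ‖η‖ ≤ 1) {f : C(X, ℝ)}
    (hf : ∀ t, f t ≠ 0 → |η t| < 1) : m f = 0 := by
  refine (apply_nonpos_of_norm_attained hm hη hf).antisymm ?_
  have := apply_nonpos_of_norm_attained hm hη (f := -f) fun t ht => hf t (by simpa using ht)
  simpa using this

theorem exists_eq_sum_smul_evalCLM {ι : Type*} [Fintype ι] {x : ι → X} (hm : m η = ‖m‖)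
    (hη : ‖η‖ ≤ 1) (hx : ∀ t, t ∉ Set.range x → |η t| < 1) :
    ∃ b : ι → ℝ, m = ∑ i, b i • ContinuousMap.evalCLM ℝ (x i) := by
  have hspan : (m : C(X, ℝ) →ₗ[ℝ] ℝ) ∈ Submodule.span ℝ (Set.range fun i =>
      ((ContinuousMap.evalCLM ℝ (x i) : C(X, ℝ) →L[ℝ] ℝ) : C(X, ℝ) →ₗ[ℝ] ℝ)) := by
    refine mem_span_of_iInf_ker_le_ker fun f hf => ?_
    simp only [Submodule.mem_iInf, LinearMap.mem_ker] at hf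
    refine apply_eq_zero_of_norm_attained hm hη fun t ht => hx t ?_
    rintro ⟨i, rfl⟩
    exact ht (hf i)
  obtain ⟨b, hb⟩ := (Submodule.mem_span_range_iff_exists_fun ℝ).1 hspan
  exact ⟨b, ContinuousLinearMap.coe_injective (by simpa using hb.symm)⟩

end NormAttained

section SumOfDiracs

variable {ι : Type*} [Fintype ι]

theorem norm_sum_smul_evalCLM_le (a : ι → ℝ) (x : ι → X) :
    ‖∑ i, a i • (ContinuousMap.evalCLM ℝ (x i) : C(X, ℝ) →L[ℝ] ℝ)‖ ≤ ∑ i, |a i| :=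
  norm_sum_le_of_le (E := C(X, ℝ) →L[ℝ] ℝ) _ fun _ _ =>
    (ContinuousLinearMap.opNorm_smul_le _ _).trans
      (mul_le_of_le_one_right (norm_nonneg _) (norm_evalCLM_le _))

theorem norm_sum_smul_evalCLM [T2Space X] (a : ι → ℝ) {x : ι → X} (hx : Function.Injective x) :
    ‖∑ i, a i • (ContinuousMap.evalCLM ℝ (x i) : C(X, ℝ) →L[ℝ] ℝ)‖ = ∑ i, |a i| := by
  refine (norm_sum_smul_evalCLM_le a x).antisymm ?_
  let _ : TopologicalSpace ι := ⊥
  have : DiscreteTopology ι := ⟨rfl⟩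
  have hemb : IsClosedEmbedding x := .of_continuous_injective_isClosedMap
    continuous_of_discreteTopology hx fun s _ => (s.toFinite.image x).isClosed
  obtain ⟨g, hg, hgx⟩ := ContinuousMap.exists_extension_forall_mem_of_isClosedEmbedding
    (⟨fun i => (SignType.sign (a i) : ℝ), continuous_of_discreteTopology⟩ : C(ι, ℝ))
    (t := Set.Icc (-1) 1)
    (fun i => by rcases lt_trichotomy (a i) 0 with h | h | h <;> simp [h]) ⟨0, by simp⟩ hemb
  have hg_norm : ‖g‖ ≤ 1 := (ContinuousMap.norm_le _ zero_le_one).2 fun t => abs_le.2 (hg t)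
  have hgx' : ∀ i, g (x i) = SignType.sign (a i) := congrFun hgx
  simpa [hgx', self_mul_sign] using
    apply_le_norm (∑ i, a i • (ContinuousMap.evalCLM ℝ (x i) : C(X, ℝ) →L[ℝ] ℝ)) hg_norm

end SumOfDiracs

end Duality

section SubdiffTV

variable {m : Radon} {η : C(Torus, ℝ)}

theorem norm_le_one_of_mem_subdiffTV (h : η ∈ subdiffTV m) : ‖η‖ ≤ 1 := by
  refine (ContinuousMap.norm_le _ zero_le_one).2 fun t => abs_le.2 ⟨?_, ?_⟩
  · have hsub := h (m - ContinuousMap.evalCLM ℝ t)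
    have := norm_sub_le m (ContinuousMap.evalCLM ℝ t)
    have := norm_evalCLM_le t
    simp only [sub_sub_cancel_left, neg_apply,
      ContinuousMap.evalCLM_apply] at hsub
    linarith
  · have hadd := h (m + ContinuousMap.evalCLM ℝ t)
    have := norm_add_le m (ContinuousMap.evalCLM ℝ t)
    have := norm_evalCLM_le t
    simp only [add_sub_cancel_left, ContinuousMap.evalCLM_apply] at hadd
    linarith

theorem norm_le_apply_of_mem_subdiffTV (h : η ∈ subdiffTV m) : ‖m‖ ≤ m η := by
  have hzero := h 0
  rw [zero_sub, neg_apply, norm_zero (E := Radon)] at hzero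
  linarith

end SubdiffTV

theorem inner_Phi (φ : C(Torus, ℝ)) (m : Radon) (p : L2) :
    inner ℝ (Phi φ m) p = m (PhiAdj φ p) := by
  have hp : Integrable (p : Torus → ℝ) volume := (Lp.memLp p).integrable (by norm_num)
  have hint : Integrable (fun t => p t • shift φ t) volume := by
    refine (hp.norm.mul_const ‖shift φ‖).mono'
      (hp.aestronglyMeasurable.smul (shift φ).continuous.aestronglyMeasurable) ?_
    filter_upwards with t
    rw [norm_smul]
    gcongr
    exact (shift φ).norm_coe_le_norm t
  have hadj : PhiAdj φ p = ∫ t, p t • shift φ t := by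
    ext x
    refine .trans (integral_congr_ae (Eventually.of_forall fun t => ?_))
      ((ContinuousMap.evalCLM ℝ x : Radon).integral_comp_comm hint)
    simp [shift, mul_comm]
  rw [hadj, ← m.integral_comp_comm hint, L2.inner_def]
  refine integral_congr_ae ?_
  filter_upwards [ContinuousMap.coeFn_toLp (p := 2) (𝕜 := ℝ) (volume : Measure Torus)
    ⟨fun t => m (shift φ t), by fun_prop⟩] with t ht
  rw [Phi, ht]
  simp

theorem discreteMeasure_apply {N : ℕ} (a : Fin N → ℝ) (x : Fin N → Torus) (f : C(Torus, ℝ)) :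
    discreteMeasure a x f = ∑ i, a i * f (x i) := by
  simp [discreteMeasure]

section Certificate

variable {φ : C(Torus, ℝ)} {lam : ℝ} {z p : L2} {m m₀ : Radon}

theorem primalObjective_eq (hz : lam • p = z - Phi φ m₀) (hm₀ : m₀ (PhiAdj φ p) = ‖m₀‖)
    (m : Radon) :
    1 / 2 * ‖Phi φ m - z‖ ^ 2 + lam * ‖m‖ = 1 / 2 * ‖Phi φ m₀ - z‖ ^ 2 + lam * ‖m₀‖ +
      1 / 2 * ‖Phi φ m - Phi φ m₀‖ ^ 2 + lam * (‖m‖ - m (PhiAdj φ p)) := by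
  have hm : Phi φ m - z = (Phi φ m - Phi φ m₀) - lam • p := by rw [hz]; abel
  have hm₀' : Phi φ m₀ - z = -(lam • p) := by rw [hz]; abel
  rw [hm, hm₀', norm_sub_sq_real, norm_neg, inner_smul_right, inner_sub_left, inner_Phi,
    inner_Phi, hm₀]
  ring

theorem isPrimalSolution_iff_of_certificate (hlam : 0 ≤ lam) (hz : lam • p = z - Phi φ m₀)
    (hp : ‖PhiAdj φ p‖ ≤ 1) (hm₀ : m₀ (PhiAdj φ p) = ‖m₀‖) :
    IsPrimalSolution φ lam z m ↔ Phi φ m = Phi φ m₀ ∧ m (PhiAdj φ p) = ‖m‖ := by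
  have hle : ∀ m : Radon, m (PhiAdj φ p) ≤ ‖m‖ := fun m => apply_le_norm m hp
  rcases hlam.eq_or_lt with rfl | hlam
  · obtain rfl : z = Phi φ m₀ := by simpa [sub_eq_zero, eq_comm] using hz
    have hval : ∀ m, Phi φ m = Phi φ m₀ → m (PhiAdj φ p) = ‖m₀‖ := fun m hm => by
      rw [← inner_Phi, hm, inner_Phi, hm₀]
    constructor
    · rintro ⟨-, h⟩
      obtain ⟨hΦ, hmin⟩ := h rfl
      exact ⟨hΦ, (hle m).antisymm ((hmin m₀ rfl).trans_eq (hval m hΦ).symm)⟩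
    · rintro ⟨hΦ, hm⟩
      refine ⟨fun h => absurd rfl h, fun _ => ⟨hΦ, fun m' hm' => ?_⟩⟩
      rw [← hm, hval m hΦ, ← hval m' hm']
      exact hle m'
  · have hobj := primalObjective_eq hz hm₀
    constructor
    · rintro ⟨h, -⟩
      have hmin := h hlam.ne' m₀
      rw [hobj m] at hmin
      have hgap : 0 ≤ lam * (‖m‖ - m (PhiAdj φ p)) := by have := hle m; bound
      have hsq : ‖Phi φ m - Phi φ m₀‖ ^ 2 = 0 :=
        le_antisymm (by linarith) (sq_nonneg _)
      have hgap_zero : lam * (‖m‖ - m (PhiAdj φ p)) = 0 := by linarith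
      exact ⟨sub_eq_zero.1 (norm_eq_zero.1 (pow_eq_zero_iff two_ne_zero |>.1 hsq)),
        (sub_eq_zero.1 ((mul_eq_zero.1 hgap_zero).resolve_left hlam.ne')).symm⟩
    · rintro ⟨hΦ, hm⟩
      refine ⟨fun _ m' => ?_, fun h => absurd h hlam.ne'⟩
      have hgap : 0 ≤ lam * (‖m'‖ - m' (PhiAdj φ p)) := by have := hle m'; bound
      have : 0 ≤ ‖Phi φ m' - Phi φ m₀‖ ^ 2 := sq_nonneg _
      rw [hobj m, hobj m', hΦ, hm, sub_self, norm_zero, sub_self]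
      linarith

theorem primalSolutions_eq_singleton_discreteMeasure {N : ℕ} {a : Fin N → ℝ}
    {x : Fin N → Torus} (hlam : 0 ≤ lam) (hz : lam • p = z - Phi φ (discreteMeasure a x))
    (hp : ‖PhiAdj φ p‖ ≤ 1) (hoff : ∀ t, t ∉ Set.range x → |PhiAdj φ p t| < 1)
    (ha : ∀ i, a i * PhiAdj φ p (x i) = |a i|)
    (hinj : Function.Injective fun b => Phi φ (discreteMeasure b x)) :
    {m | IsPrimalSolution φ lam z m} = {discreteMeasure a x} := by
  have hattained : discreteMeasure a x (PhiAdj φ p) = ‖discreteMeasure a x‖ := by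
    refine (apply_le_norm _ hp).antisymm ((norm_sum_smul_evalCLM_le a x).trans_eq ?_)
    simp only [discreteMeasure_apply, ha]
  ext m
  rw [Set.mem_ofPred_eq, isPrimalSolution_iff_of_certificate hlam hz hp hattained,
    Set.mem_singleton_iff]
  constructor
  · rintro ⟨hΦ, hm⟩
    obtain ⟨b, rfl⟩ := exists_eq_sum_smul_evalCLM hm hp hoff
    rw [show b = a from hinj hΦ, discreteMeasure]
  · rintro rfl
    exact ⟨rfl, hattained⟩

end Certificate

theorem hasDerivAt_of_hasDerivAt_apply {X E : Type*} [TopologicalSpace X] [CompactSpace X]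
    [NormedAddCommGroup E] [NormedSpace ℝ E] [CompleteSpace E] {F F' : ℝ → C(X, E)}
    (hF' : Continuous F') (h : ∀ t s, HasDerivAt (fun s => F s t) (F' s t) s) (s : ℝ) :
    HasDerivAt F (F' s) s := by
  have hFTC : F = fun u => F s + ∫ r in s..u, F' r := by
    ext u t
    have heval := (ContinuousMap.evalCLM ℝ t : C(X, E) →L[ℝ] E).intervalIntegral_comp_comm
      (hF'.intervalIntegrable (μ := volume) s u)
    have hsub := intervalIntegral.integral_eq_sub_of_hasDerivAt (fun r (_ : r ∈ Set.uIcc s u) =>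
      h t r) (Continuous.intervalIntegrable (by fun_prop) _ _)
    simp only [ContinuousMap.evalCLM_apply] at heval
    rw [ContinuousMap.add_apply, ← heval, hsub, add_sub_cancel]
  rw [hFTC]
  exact (intervalIntegral.integral_hasDerivAt_right (hF'.intervalIntegrable s s)
    (hF'.stronglyMeasurableAtFilter _ _) hF'.continuousAt).const_add _

theorem deriv_inner_const {H : Type*} [NormedAddCommGroup H] [InnerProductSpace ℝ H] {ψ : ℝ → H}
    (hψ : Differentiable ℝ ψ) (p : H) :
    deriv (fun t => inner ℝ (ψ t) p) = fun t => inner ℝ (deriv ψ t) p :=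
  funext fun t => by simpa using ((hψ t).hasDerivAt.inner ℝ (hasDerivAt_const t p)).deriv

theorem torusDeriv_coe (f : Torus → ℝ) (s : ℝ) :
    torusDeriv f (s : Torus) = deriv (fun s : ℝ => f (s : Torus)) s := by
  simpa [torusDeriv] using deriv_comp_const_add (fun r : ℝ => f (r : Torus)) s 0

/-- The continuous map `s ↦ φ(s - ·)` from `𝕋` to `C(𝕋)`. -/
def reflect (φ : C(Torus, ℝ)) : C(Torus, C(Torus, ℝ)) :=
  ContinuousMap.curry ⟨fun q : Torus × Torus => φ (q.1 - q.2), by fun_prop⟩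

/-- The feature map `s ↦ Φ δ_s = φ(s - ·)`, lifted to a `1`-periodic curve in `L²(𝕋)`. -/
def feature (φ : C(Torus, ℝ)) (s : ℝ) : L2 :=
  ContinuousMap.toLp 2 volume ℝ (reflect φ s)

section Feature

variable {φ : C(Torus, ℝ)}

theorem periodic_feature : Function.Periodic (feature φ) 1 := fun s => by
  simp only [feature, AddCircle.coe_add_period]

theorem Phi_discreteMeasure {N : ℕ} (a X : Fin N → ℝ) :
    Phi φ (discreteMeasure a fun i => (X i : Torus)) = ∑ i, a i • feature φ (X i) := by
  have hPhi_evalCLM : ∀ s : ℝ, Phi φ (ContinuousMap.evalCLM ℝ (s : Torus)) = feature φ s :=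
    fun _ => rfl
  refine ext_inner_right ℝ fun p => ?_
  simp [inner_Phi, discreteMeasure, sum_inner, inner_smul_left, ← hPhi_evalCLM]

theorem inner_feature (p : L2) (s : ℝ) : inner ℝ (feature φ s) p = PhiAdj φ p (s : Torus) :=
  inner_Phi φ (ContinuousMap.evalCLM ℝ (s : Torus)) p

theorem hasDerivAt_feature (hφ : IsC 1 φ) (s : ℝ) :
    HasDerivAt (feature φ) (feature ⟨torusDeriv φ, continuous_torusDeriv hφ⟩ s) s := by
  set φ' : C(Torus, ℝ) := ⟨torusDeriv φ, continuous_torusDeriv hφ⟩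
  have hφ' : ∀ r : ℝ, HasDerivAt (fun r : ℝ => φ (r : Torus)) (φ' (r : Torus)) r := fun r =>
    (hφ.differentiable one_ne_zero r).hasDerivAt.congr_deriv (torusDeriv_coe φ r).symm
  have hreflect : HasDerivAt (fun r : ℝ => reflect φ r) (reflect φ' s) s := by
    refine hasDerivAt_of_hasDerivAt_apply (F' := fun r : ℝ => reflect φ' r)
      ((reflect φ').continuous.comp (AddCircle.continuous_mk' 1)) (fun t r => ?_) s
    obtain ⟨t, rfl⟩ := QuotientAddGroup.mk_surjective t
    exact (hφ' (r - t)).comp_sub_const r t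
  exact (ContinuousMap.toLp 2 volume ℝ : C(Torus, ℝ) →L[ℝ] L2).hasFDerivAt.comp_hasDerivAt s
    hreflect

theorem deriv_feature (hφ : IsC 1 φ) :
    deriv (feature φ) = feature ⟨torusDeriv φ, continuous_torusDeriv hφ⟩ :=
  funext fun s => (hasDerivAt_feature hφ s).deriv

theorem contDiff_feature {n : ℕ} {φ : C(Torus, ℝ)} (hφ : IsC n φ) :
    ContDiff ℝ n (feature φ) := by
  induction n generalizing φ with
  | zero =>
    exact contDiff_zero.2 ((ContinuousMap.toLp 2 volume ℝ : C(Torus, ℝ) →L[ℝ] L2).continuous.comp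
      ((reflect φ).continuous.comp (AddCircle.continuous_mk' 1)))
  | succ n ih =>
    have hφ₁ : IsC 1 φ := ContDiff.of_le hφ (by simp)
    push_cast at hφ ⊢
    refine contDiff_succ_iff_deriv.2
      ⟨fun s => (hasDerivAt_feature hφ₁ s).differentiableAt, by simp, ?_⟩
    rw [deriv_feature hφ₁]
    refine ih ?_
    have hderiv := (contDiff_succ_iff_deriv.1 hφ).2.2
    rwa [← funext (torusDeriv_coe φ)] at hderiv

theorem Gam_coe (hφ : IsC 2 φ) {N : ℕ} (X : Fin N → ℝ) (q : (Fin N → ℝ) × (Fin N → ℝ)) :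
    Gam φ hφ (fun i => (X i : Torus)) q =
      ∑ i, q.1 i • feature φ (X i) + ∑ i, q.2 i • deriv (feature φ) (X i) := by
  rw [Gam, Phi_discreteMeasure, Phi_discreteMeasure,
    deriv_feature (ContDiff.of_le hφ (by norm_num))]
  rfl

theorem torusDeriv_PhiAdj (hφ : IsC 1 φ) (p : L2) (s : ℝ) :
    torusDeriv (PhiAdj φ p) (s : Torus) = inner ℝ (deriv (feature φ) s) p := by
  simp only [torusDeriv_coe, ← inner_feature,
    deriv_inner_const (fun r => (hasDerivAt_feature hφ r).differentiableAt) p]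

theorem torusDeriv_torusDeriv_PhiAdj (hφ : IsC 2 φ) (p : L2) (s : ℝ) :
    torusDeriv (torusDeriv (PhiAdj φ p)) (s : Torus) =
      inner ℝ (deriv (deriv (feature φ)) s) p := by
  have hderiv : ContDiff ℝ 1 (deriv (feature φ)) :=
    (contDiff_succ_iff_deriv.1 (contDiff_feature (n := 2) hφ)).2.2
  rw [torusDeriv_coe]
  simp only [torusDeriv_PhiAdj (ContDiff.of_le hφ (by norm_num)),
    deriv_inner_const (hderiv.differentiable one_ne_zero)]

end Feature

theorem lt_of_strictConcaveOn_of_hasDerivAt_zero {g : ℝ → ℝ} {S : Set ℝ} {x t : ℝ}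
    (hg : StrictConcaveOn ℝ S g) (hx : x ∈ S) (hgx : HasDerivAt g 0 x) (ht : t ∈ S)
    (htx : t ≠ x) : g t < g x := by
  rcases htx.lt_or_gt with h | h
  · have hslope := hg.lt_slope_of_hasDerivAt ht hx h hgx
    rw [slope_def_field, lt_div_iff₀ (sub_pos.2 h)] at hslope
    linarith
  · have hslope := hg.slope_lt_of_hasDerivAt hx ht h hgx
    rw [slope_def_field, div_lt_iff₀ (sub_pos.2 h)] at hslope
    linarith

theorem abs_lt_one_of_strictConcaveOn {η : ℝ → ℝ} {S : Set ℝ} {σ x t : ℝ}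
    (hη : StrictConcaveOn ℝ S fun t => σ * η t) (hσ : |σ| = 1) (hx : x ∈ S) (hηx : η x = σ)
    (hderiv : HasDerivAt η 0 x) (ht : t ∈ S) (hpos : 0 < σ * η t) (htx : t ≠ x) :
    |η t| < 1 := by
  have hlt := lt_of_strictConcaveOn_of_hasDerivAt_zero hη hx
    ((hderiv.const_mul σ).congr_deriv (mul_zero σ)) ht htx
  calc |η t| = σ * η t := by rw [← abs_of_pos hpos, abs_mul, hσ, one_mul]
    _ < σ * σ := by simpa only [hηx] using hlt
    _ = 1 := by rw [← abs_mul_abs_self, hσ, one_mul]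

theorem deriv_deriv_nonpos_of_isLocalMax {f : ℝ → ℝ} {x : ℝ} (h : IsLocalMax f x)
    (hf : ContinuousAt f x) : deriv (deriv f) x ≤ 0 := by
  by_contra! hpos
  have hmin := isLocalMin_of_deriv_deriv_pos hpos h.deriv_eq_zero hf
  have hconst : f =ᶠ[𝓝 x] fun _ => f x := (h.and hmin).mono fun _ ht => ht.1.antisymm ht.2
  have hzero : deriv (deriv f) x = 0 := by simpa using hconst.deriv.deriv_eq
  exact hpos.ne' hzero

section AbsLeOne

variable {η : ℝ → ℝ} {x : ℝ}

theorem isLocalMax_mul_of_abs_le_one (hη : ∀ t, |η t| ≤ 1) (hx : |η x| = 1) :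
    IsLocalMax (fun t => η x * η t) x :=
  Eventually.of_forall fun t => calc
    η x * η t ≤ |η x| * |η t| := (le_abs_self _).trans_eq (abs_mul _ _)
    _ ≤ |η x| * |η x| := by rw [hx]; gcongr; exact hη t
    _ = η x * η x := abs_mul_abs_self _

theorem deriv_eq_zero_of_abs_le_one (hη : ∀ t, |η t| ≤ 1) (hx : |η x| = 1) : deriv η x = 0 := by
  have h := (isLocalMax_mul_of_abs_le_one hη hx).deriv_eq_zero
  rw [deriv_const_mul_field] at h
  exact (mul_eq_zero.1 h).resolve_left (abs_pos.1 (hx ▸ one_pos))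

theorem mul_deriv_deriv_nonpos_of_abs_le_one (hcont : ContinuousAt η x) (hη : ∀ t, |η t| ≤ 1)
    (hx : |η x| = 1) : η x * deriv (deriv η) x ≤ 0 := by
  have h := deriv_deriv_nonpos_of_isLocalMax (isLocalMax_mul_of_abs_le_one hη hx)
    (continuousAt_const.mul hcont)
  rwa [deriv_const_mul_field', deriv_const_mul_field] at h

end AbsLeOne

section Certificate

variable {H : Type*} [NormedAddCommGroup H] [InnerProductSpace ℝ H]

theorem mem_of_eventually_norm_le {K : Submodule ℝ H} [K.HasOrthogonalProjection] {p₀ : H}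
    (h : ∀ᶠ p in 𝓝 p₀, p - p₀ ∈ Kᗮ → ‖p₀‖ ≤ ‖p‖) : p₀ ∈ K := by
  rw [← K.orthogonal_orthogonal, Submodule.mem_orthogonal']
  intro q hq
  have hline : Tendsto (fun t : ℝ => p₀ + t • q) (𝓝 0) (𝓝 p₀) :=
    (by fun_prop : Continuous fun t : ℝ => p₀ + t • q).tendsto' 0 p₀ (by simp)
  have hmin : IsLocalMin (fun t : ℝ => ‖p₀ + t • q‖ ^ 2) 0 := by
    filter_upwards [hline.eventually h] with t ht
    rw [zero_smul, add_zero]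
    gcongr
    exact ht (by simpa using Kᗮ.smul_mem t hq)
  have hderiv : HasDerivAt (fun t : ℝ => ‖p₀ + t • q‖ ^ 2) (2 * inner ℝ p₀ q) 0 := by
    simpa using (((hasDerivAt_id (0 : ℝ)).smul_const q).const_add p₀).norm_sq
  simpa using hmin.hasDerivAt_eq_zero hderiv

variable {ι : Type*} {T : ℝ} {ψ : ℝ → H} {X₀ s : ι → ℝ} {p₀ : H}

/-- The function `η = ⟪ψ ·, p⟫` on `ℝ/Tℤ` is a nondegenerate dual certificate for spikes at the
positions `X i` with signs `s i`: it interpolates the signs at the spikes with a nondegenerate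
extremum there, and has modulus `< 1` elsewhere. Positions are lifted to `ℝ`. -/
structure IsNondegenerateCertificate (T : ℝ) (ψ : ℝ → H) (X s : ι → ℝ) (p : H) : Prop where
  abs_sign : ∀ i, |s i| = 1
  inner_eq : ∀ i, inner ℝ (ψ (X i)) p = s i
  inner_deriv_eq_zero : ∀ i, inner ℝ (deriv ψ (X i)) p = 0
  mul_inner_deriv_deriv_neg : ∀ i, s i * inner ℝ (deriv (deriv ψ) (X i)) p < 0
  abs_inner_lt_one : ∀ t : ℝ, (∀ i, (t : AddCircle T) ≠ X i) → |inner ℝ (ψ t) p| < 1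

theorem periodic_eq_of_coe_eq {β : Type*} {f : ℝ → β} (hf : Function.Periodic f T) {r t : ℝ}
    (h : (r : AddCircle T) = t) : f r = f t := by
  rw [← hf.lift_coe, h, hf.lift_coe]

theorem strictConcaveOn_mul_inner {S : Set ℝ} (hS : Convex ℝ S) (hψ : ContDiff ℝ 2 ψ) {p : H}
    {σ : ℝ} (hneg : ∀ t ∈ S, σ * inner ℝ (deriv (deriv ψ) t) p < 0) :
    StrictConcaveOn ℝ S fun t => σ * inner ℝ (ψ t) p := by
  have hψ' : ContDiff ℝ 1 (deriv ψ) := (contDiff_succ_iff_deriv.1 hψ).2.2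
  have hcont : Continuous ψ := hψ.continuous
  refine strictConcaveOn_of_deriv2_neg hS (by fun_prop) fun t ht => ?_
  simpa only [Function.iterate_succ, Function.iterate_zero, Function.comp_apply, id,
    deriv_const_mul_field', deriv_inner_const (hψ.differentiable two_ne_zero),
    deriv_inner_const (hψ'.differentiable one_ne_zero)] using hneg t (interior_subset ht)

theorem eventually_abs_inner_lt_one_near (hψ : ContDiff ℝ 2 ψ) {σ x₀ : ℝ} (hσ : |σ| = 1)
    (hx₀ : inner ℝ (ψ x₀) p₀ = σ) (hneg : σ * inner ℝ (deriv (deriv ψ) x₀) p₀ < 0) :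
    ∀ᶠ z : (ℝ × H) × ℝ in 𝓝 ((x₀, p₀), x₀), inner ℝ (ψ z.1.1) z.1.2 = σ →
      inner ℝ (deriv ψ z.1.1) z.1.2 = 0 → z.2 ≠ z.1.1 → |inner ℝ (ψ z.2) z.1.2| < 1 := by
  have hψ' : ContDiff ℝ 1 (deriv ψ) := (contDiff_succ_iff_deriv.1 hψ).2.2
  have hcont : Continuous ψ := hψ.continuous
  have hcont'' : Continuous (deriv (deriv ψ)) := hψ'.continuous_deriv le_rfl
  have hcurv : ∀ᶠ z : ℝ × H in 𝓝 (x₀, p₀), σ * inner ℝ (deriv (deriv ψ) z.1) z.2 < 0 :=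
    (continuous_const.mul ((hcont''.comp continuous_fst).inner continuous_snd)
      ).continuousAt.eventually_lt_const hneg
  have hpos : ∀ᶠ z : ℝ × H in 𝓝 (x₀, p₀), 0 < σ * inner ℝ (ψ z.1) z.2 :=
    (by fun_prop : Continuous fun z : ℝ × H => σ * inner ℝ (ψ z.1) z.2
      ).continuousAt.eventually_const_lt
        (by simp only [hx₀, ← abs_mul_abs_self σ, hσ, one_mul, one_pos])
  obtain ⟨r, hr, hball⟩ := Metric.eventually_nhds_iff_ball.1 (hcurv.and hpos)
  simp only [← ball_prod_same, Set.mem_prod, Prod.forall] at hball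
  filter_upwards [Metric.ball_mem_nhds ((x₀, p₀), x₀) hr] with ⟨⟨x, p⟩, t⟩ hz hval hderiv htx
  simp only [← ball_prod_same, Set.mem_prod] at hz
  obtain ⟨⟨hx, hp⟩, ht⟩ := hz
  refine abs_lt_one_of_strictConcaveOn (η := fun t => inner ℝ (ψ t) p) (strictConcaveOn_mul_inner
    (convex_ball x₀ r) hψ fun t ht => (hball t p ⟨ht, hp⟩).1) hσ hx hval ?_ ht
    (hball t p ⟨ht, hp⟩).2 htx
  have hinner := (hψ.differentiable two_ne_zero x).hasDerivAt.inner ℝ (hasDerivAt_const x p)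
  simpa [hderiv] using hinner

theorem IsNondegenerateCertificate.eventually_abs_inner_lt_one [Fact (0 < T)]
    (hψ : ContDiff ℝ 2 ψ) (hper : Function.Periodic ψ T)
    (h : IsNondegenerateCertificate T ψ X₀ s p₀) :
    ∀ᶠ q : (ι → ℝ) × H in 𝓝 (X₀, p₀), (∀ i, inner ℝ (ψ (q.1 i)) q.2 = s i) →
      (∀ i, inner ℝ (deriv ψ (q.1 i)) q.2 = 0) →
      ∀ t : ℝ, (∀ i, (t : AddCircle T) ≠ q.1 i) → |inner ℝ (ψ t) q.2| < 1 := by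
  have hcont : Continuous ψ := hψ.continuous
  suffices hIcc : ∀ᶠ q : (ι → ℝ) × H in 𝓝 (X₀, p₀), ∀ t ∈ Set.Icc 0 T,
      (∀ i, inner ℝ (ψ (q.1 i)) q.2 = s i) → (∀ i, inner ℝ (deriv ψ (q.1 i)) q.2 = 0) →
      (∀ i, (t : AddCircle T) ≠ q.1 i) → |inner ℝ (ψ t) q.2| < 1 by
    filter_upwards [hIcc] with q hq hval hderiv t ht
    obtain ⟨r, hr, hrt : (r : AddCircle T) = t⟩ :=
      (AddCircle.coe_image_Ico_eq T 0).ge (Set.mem_univ (t : AddCircle T))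
    rw [← periodic_eq_of_coe_eq hper hrt]
    exact hq r ⟨hr.1, by linarith [hr.2]⟩ hval hderiv (hrt ▸ ht)
  refine isCompact_Icc.eventually_forall_of_forall_eventually fun t _ => ?_
  by_cases ht : ∀ i, (t : AddCircle T) ≠ X₀ i
  · filter_upwards [(by fun_prop : Continuous fun z : ((ι → ℝ) × H) × ℝ =>
      |inner ℝ (ψ z.2) z.1.2|).continuousAt.eventually_lt_const (h.abs_inner_lt_one t ht)]
      with z hz _ _ _ using hz
  · obtain ⟨i, hi⟩ : ∃ i, (t : AddCircle T) = X₀ i := by simpa using ht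
    have hshift : ∀ r, ((r + (X₀ i - t) : ℝ) : AddCircle T) = r := fun r => by
      rw [AddCircle.coe_add, AddCircle.coe_sub, hi, sub_self, add_zero]
    have hpull : Tendsto (fun z : ((ι → ℝ) × H) × ℝ => ((z.1.1 i, z.1.2), z.2 + (X₀ i - t)))
        (𝓝 ((X₀, p₀), t)) (𝓝 ((X₀ i, p₀), X₀ i)) := Continuous.tendsto' (by fun_prop) _ _ (by simp)
    filter_upwards [hpull.eventually (eventually_abs_inner_lt_one_near hψ (h.abs_sign i)
      (h.inner_eq i) (h.mul_inner_deriv_deriv_neg i))] with z hz hval hderiv hne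
    rw [← periodic_eq_of_coe_eq hper (hshift z.2)]
    exact hz (hval i) (hderiv i) fun heq => hne i (by rw [← hshift z.2, heq])

end Certificate

section ImplicitFunction

variable {E W F : Type*} [NormedAddCommGroup E] [NormedSpace ℝ E] [CompleteSpace E]
  [NormedAddCommGroup W] [NormedSpace ℝ W] [CompleteSpace W]
  [NormedAddCommGroup F] [NormedSpace ℝ F] [CompleteSpace F] {f : E × W → F}

theorem contDiffAt_of_eventually_apply_eq {n : WithTop ℕ∞} (hn : n ≠ 0) {u : E → W} {v₀ : E}
    (hf : ContDiffAt ℝ n f (v₀, u v₀))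
    (hinv : (fderiv ℝ f (v₀, u v₀) ∘L .inr ℝ E W).IsInvertible) (hu : ContinuousAt u v₀)
    (hsol : ∀ᶠ v in 𝓝 v₀, f (v, u v) = f (v₀, u v₀)) : ContDiffAt ℝ n u v₀ := by
  have hgraph : Tendsto (fun v => (v, u v)) (𝓝 v₀) (𝓝 (v₀, u v₀)) := continuousAt_id.prodMk hu
  refine (hf.contDiffAt_implicitFunction hn hinv).congr_of_eventuallyEq ?_
  filter_upwards [hsol, hgraph.eventually (hf.eventually_apply_eq_iff_implicitFunction hn hinv)]
    with v hv hiff using (hiff.1 hv).symm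

/- Smoothness of every order holds on a single `U`: near each of its points `u` is, by local
uniqueness, the implicit function based at that point. -/
theorem exists_isOpen_implicitFunction (hf : ContDiff ℝ 1 f) {z₀ : E × W}
    (hinv : (fderiv ℝ f z₀ ∘L .inr ℝ E W).IsInvertible) :
    ∃ U : Set E, IsOpen U ∧ z₀.1 ∈ U ∧ ∃ u : E → W, u z₀.1 = z₀.2 ∧
      (∀ v ∈ U, f (v, u v) = f z₀) ∧
      ∀ n : WithTop ℕ∞, n ≠ 0 → ContDiff ℝ n f → ContDiffOn ℝ n u U := by
  have hf₀ : ContDiffAt ℝ 1 f z₀ := hf.contDiffAt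
  set u := hf₀.implicitFunction one_ne_zero hinv
  have hu₀ : u z₀.1 = z₀.2 := hf₀.implicitFunction_apply_self one_ne_zero hinv
  have hu : ContDiffAt ℝ 1 u z₀.1 := hf₀.contDiffAt_implicitFunction one_ne_zero hinv
  have hcont : ∀ᶠ v in 𝓝 z₀.1, ContinuousAt u v :=
    (hu.eventually (by simp)).mono fun _ hv => hv.continuousAt
  have hsol : ∀ᶠ v in 𝓝 z₀.1, f (v, u v) = f z₀ :=
    hf₀.eventually_apply_implicitFunction one_ne_zero hinv
  have hinv' : ∀ᶠ v in 𝓝 z₀.1, (fderiv ℝ f (v, u v) ∘L .inr ℝ E W).IsInvertible := by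
    have hpartial : ContinuousAt (fun v => fderiv ℝ f (v, u v) ∘L .inr ℝ E W) z₀.1 :=
      ((hf.continuous_fderiv one_ne_zero).continuousAt.comp
        (continuousAt_id.prodMk hu.continuousAt)).clm_comp continuousAt_const
    have hinv₀ : (fderiv ℝ f (z₀.1, u z₀.1) ∘L .inr ℝ E W).IsInvertible := hu₀ ▸ hinv
    exact hpartial.eventually (ContinuousLinearEquiv.isOpen.mem_nhds hinv₀)
  obtain ⟨U, hU, hUopen, hz₀⟩ := eventually_nhds_iff.1 (hcont.and (hsol.and hinv'))
  refine ⟨U, hUopen, hz₀, u, hu₀, fun v hv => (hU v hv).2.1, fun n hn hfn v hv => ?_⟩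
  refine (contDiffAt_of_eventually_apply_eq hn hfn.contDiffAt (hU v hv).2.2 (hU v hv).1
    ?_).contDiffWithinAt
  filter_upwards [hUopen.mem_nhds hv] with v' hv'
  rw [(hU v' hv').2.1, (hU v hv).2.1]

end ImplicitFunction

theorem isInvertible_of_injective {W : Type*} [NormedAddCommGroup W] [NormedSpace ℝ W]
    [FiniteDimensional ℝ W] {L : W →L[ℝ] W} (hL : Function.Injective L) : L.IsInvertible :=
  ⟨(LinearEquiv.ofInjectiveEndo (L : W →ₗ[ℝ] W) hL).toContinuousLinearEquiv, rfl⟩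

section Moments

variable {H : Type*} [NormedAddCommGroup H] [InnerProductSpace ℝ H] {ι : Type*}
  {ψ : ℝ → H}

/-- Amplitudes and (lifted) positions of spikes indexed by `ι`. -/
abbrev SpikeData (ι : Type*) := (ι → ℝ) × (ι → ℝ)

/-- The values at the points `X i` of `⟪ψ ·, h⟫` and of its derivative. -/
def momentMap (ψ : ℝ → H) (X : ι → ℝ) : H →L[ℝ] SpikeData ι :=
  (ContinuousLinearMap.pi fun i => innerSL ℝ (ψ (X i))).prod
    (ContinuousLinearMap.pi fun i => innerSL ℝ (deriv ψ (X i)))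

theorem momentMap_apply (X : ι → ℝ) (h : H) : momentMap ψ X h =
    (fun i => inner ℝ (ψ (X i)) h, fun i => inner ℝ (deriv ψ (X i)) h) := rfl

theorem IsNondegenerateCertificate.momentMap_eq {T : ℝ} {X s : ι → ℝ} {p : H}
    (h : IsNondegenerateCertificate T ψ X s p) : momentMap ψ X p = (s, 0) :=
  Prod.ext (funext h.inner_eq) (funext h.inner_deriv_eq_zero)

theorem hasFDerivAt_momentMap_apply [Finite ι] {Z : Type*} [NormedAddCommGroup Z]
    [NormedSpace ℝ Z] {z₀ : Z} (hψ : Differentiable ℝ ψ) (hψ' : Differentiable ℝ (deriv ψ))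
    {X : Z → ι → ℝ} {R : Z → H} {R' : Z →L[ℝ] H} (hX : DifferentiableAt ℝ X z₀)
    (hR : HasFDerivAt R R' z₀) (hR₀ : R z₀ = 0) :
    HasFDerivAt (fun z => momentMap ψ (X z) (R z)) (momentMap ψ (X z₀) ∘L R') z₀ := by
  have := Fintype.ofFinite ι
  have hinner : ∀ {g : Z → H}, DifferentiableAt ℝ g z₀ →
      HasFDerivAt (fun z => inner ℝ (g z) (R z)) (innerSL ℝ (g z₀) ∘L R') z₀ := fun hg =>
    (hg.hasFDerivAt.inner ℝ hR).congr_fderiv (by ext; simp [hR₀])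
  have hXi := differentiableAt_pi.1 hX
  exact (hasFDerivAt_pi.2 fun i => hinner ((hψ _).comp z₀ (hXi i))).prodMk
    (hasFDerivAt_pi.2 fun i => hinner ((hψ' _).comp z₀ (hXi i)))

variable [Fintype ι]

/-- The superposition of the features `ψ` at given positions with given amplitudes. -/
def superpose (ψ : ℝ → H) (u : SpikeData ι) : H := ∑ i, u.1 i • ψ (u.2 i)

/-- The paper's `Γ_X`, whose range is tangent to the superpositions of spikes located at `X`. -/
def tangentMap (ψ : ℝ → H) (X : ι → ℝ) : SpikeData ι →L[ℝ] H :=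
  ∑ i, ((ContinuousLinearMap.proj i ∘L .fst ℝ (ι → ℝ) (ι → ℝ)).smulRight (ψ (X i)) +
    (ContinuousLinearMap.proj i ∘L .snd ℝ (ι → ℝ) (ι → ℝ)).smulRight (deriv ψ (X i)))

theorem tangentMap_apply (X : ι → ℝ) (q : SpikeData ι) :
    tangentMap ψ X q = ∑ i, (q.1 i • ψ (X i) + q.2 i • deriv ψ (X i)) := by
  simp [tangentMap]

theorem inner_tangentMap (X : ι → ℝ) (q : SpikeData ι) (h : H) :
    inner ℝ (tangentMap ψ X q) h =
      ∑ i, (q.1 i * (momentMap ψ X h).1 i + q.2 i * (momentMap ψ X h).2 i) := by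
  simp [tangentMap_apply, momentMap_apply, sum_inner, inner_add_left, inner_smul_left]

theorem mem_range_tangentMap_orthogonal {X : ι → ℝ} {h : H} :
    h ∈ (tangentMap ψ X).rangeᗮ ↔ momentMap ψ X h = 0 := by
  classical
  refine ⟨fun hh => ?_, fun hh => ?_⟩
  · have hΓ : ∀ q, inner ℝ (tangentMap ψ X q) h = 0 := fun q => hh _ ⟨q, rfl⟩
    refine Prod.ext (funext fun i => ?_) (funext fun i => ?_)
    · simpa [inner_tangentMap, Pi.single_apply] using hΓ (Pi.single i 1, 0)
    · simpa [inner_tangentMap, Pi.single_apply] using hΓ (0, Pi.single i 1)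
  · rintro _ ⟨q, rfl⟩
    exact (inner_tangentMap X q h).trans (by simp [hh])

theorem injective_momentMap_comp_tangentMap {X : ι → ℝ}
    (hΓ : Function.Injective (tangentMap ψ X)) :
    Function.Injective (momentMap ψ X ∘L tangentMap ψ X) := by
  refine (injective_iff_map_eq_zero _).2 fun q hq => hΓ ?_
  rw [map_zero, ← inner_self_eq_zero (𝕜 := ℝ)]
  exact mem_range_tangentMap_orthogonal.2 hq _ ⟨q, rfl⟩

theorem linearIndependent_of_injective_tangentMap {X : ι → ℝ}
    (hΓ : Function.Injective (tangentMap ψ X)) : LinearIndependent ℝ fun i => ψ (X i) := by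
  refine linearIndependent_iff_injective_fintypeLinearCombination.2 fun b c hbc => ?_
  have hΓbc : tangentMap ψ X (b, 0) = tangentMap ψ X (c, 0) := by
    simpa [tangentMap_apply, Fintype.linearCombination_apply] using hbc
  exact congrArg Prod.fst (hΓ hΓbc)

/-- Multiplication of the position increments by the amplitudes `a`, relating `tangentMap` to the
derivative of `superpose`. -/
def scaleShifts (a : ι → ℝ) : SpikeData ι →L[ℝ] SpikeData ι :=
  (ContinuousLinearMap.id ℝ (ι → ℝ)).prodMap (ContinuousLinearMap.mul ℝ (ι → ℝ) a)

theorem injective_scaleShifts {a : ι → ℝ} (ha : ∀ i, a i ≠ 0) :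
    Function.Injective (scaleShifts a) :=
  Function.injective_id.prodMap fun _ _ h => funext fun i =>
    mul_left_cancel₀ (ha i) (congrFun h i)

theorem hasFDerivAt_superpose (hψ : Differentiable ℝ ψ) (u : SpikeData ι) :
    HasFDerivAt (superpose ψ) (tangentMap ψ u.2 ∘L scaleShifts u.1) u := by
  have hamp : ∀ i, HasFDerivAt (fun u : SpikeData ι => u.1 i)
      (ContinuousLinearMap.proj i ∘L .fst ℝ (ι → ℝ) (ι → ℝ)) u :=
    hasFDerivAt_pi'.1 hasFDerivAt_fst
  have hpos : ∀ i, HasFDerivAt (fun u : SpikeData ι => u.2 i)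
      (ContinuousLinearMap.proj i ∘L .snd ℝ (ι → ℝ) (ι → ℝ)) u :=
    hasFDerivAt_pi'.1 hasFDerivAt_snd
  refine (HasFDerivAt.fun_sum fun i _ => (hamp i).smul
    ((hψ (u.2 i)).hasDerivAt.hasFDerivAt.comp u (hpos i))).congr_fderiv ?_
  ext q <;> simp [tangentMap_apply, scaleShifts, mul_smul, add_comm]

end Moments

section Branch

variable {H : Type*} [NormedAddCommGroup H] [InnerProductSpace ℝ H]

theorem norm_le_of_mem_orthogonal_of_add_mem {K : Submodule ℝ H} {q w : H} (hq : q ∈ Kᗮ)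
    (hqw : q + w ∈ K) : ‖q‖ ≤ ‖w‖ := by
  have horth : ‖q‖ * ‖q‖ + inner ℝ q w = 0 := by
    rw [← real_inner_self_eq_norm_mul_norm, ← inner_add_right]
    exact K.inner_left_of_mem_orthogonal hqw hq
  have hcs := neg_le_of_abs_le (abs_real_inner_le_norm q w)
  by_contra! hlt
  nlinarith [norm_nonneg w]

variable {ι : Type*} [Fintype ι] {ψ : ℝ → H} {s : ι → ℝ} {u₀ : SpikeData ι} {p₀ : H}

/-- The residual at the data `y + w` and the spikes `u`, for `z = ((lam, w), u)`. -/
def residual (ψ : ℝ → H) (y : H) (z : (ℝ × H) × SpikeData ι) : H :=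
  superpose ψ z.2 - (y + z.1.2)

/-- The first order optimality conditions of `P_lam(y + w)` for spikes `u` with signs `s`, at
`z = ((lam, w), u)`: they say that `p = -residual / lam` satisfies `⟪ψ (X i), p⟫ = s i` and
`⟪ψ' (X i), p⟫ = 0`, multiplied by `lam` so as to make sense at `lam = 0`. -/
def optimalitySystem (ψ : ℝ → H) (y : H) (s : ι → ℝ) (z : (ℝ × H) × SpikeData ι) : SpikeData ι :=
  momentMap ψ z.2.2 (residual ψ y z) + z.1.1 • (s, 0)

theorem contDiff_optimalitySystem {n : WithTop ℕ∞} (hψ : ContDiff ℝ (n + 1) ψ) (y : H)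
    (s : ι → ℝ) : ContDiff ℝ n (optimalitySystem ψ y s) := by
  have hψ₀ : ContDiff ℝ n ψ := hψ.of_le le_self_add
  have hψ₁ : ContDiff ℝ n (deriv ψ) := (contDiff_succ_iff_deriv.1 hψ).2.2
  have hres : ContDiff ℝ n (residual (ι := ι) ψ y) := by
    unfold residual superpose
    fun_prop
  have hpos : ∀ i, ContDiff ℝ n fun z : (ℝ × H) × SpikeData ι => z.2.2 i := fun i => by fun_prop
  have hmoment : ContDiff ℝ n fun z : (ℝ × H) × SpikeData ι =>
      momentMap ψ z.2.2 (residual ψ y z) :=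
    (contDiff_pi.2 fun i => (hψ₀.comp (hpos i)).inner ℝ hres).prodMk
      (contDiff_pi.2 fun i => (hψ₁.comp (hpos i)).inner ℝ hres)
  exact hmoment.add (contDiff_fst.fst.smul contDiff_const)

theorem fderiv_optimalitySystem_comp_inr (hψ : ContDiff ℝ 2 ψ) (u₀ : SpikeData ι) (s : ι → ℝ) :
    fderiv ℝ (optimalitySystem ψ (superpose ψ u₀) s) (0, u₀) ∘L .inr ℝ (ℝ × H) (SpikeData ι) =
      momentMap ψ u₀.2 ∘L tangentMap ψ u₀.2 ∘L scaleShifts u₀.1 := by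
  have hψ₀ : Differentiable ℝ ψ := hψ.differentiable two_ne_zero
  have hψ₁ : Differentiable ℝ (deriv ψ) :=
    (contDiff_succ_iff_deriv.1 hψ).2.2.differentiable one_ne_zero
  have hpartial : HasFDerivAt (fun u => optimalitySystem ψ (superpose ψ u₀) s (0, u)) _ u₀ :=
    (((contDiff_optimalitySystem (n := 1) hψ (superpose ψ u₀) s).differentiable one_ne_zero
      (0, u₀)).hasFDerivAt).comp u₀ (hasFDerivAt_prodMk_right 0 u₀)
  refine hpartial.unique ?_
  have hmoment := hasFDerivAt_momentMap_apply hψ₀ hψ₁ (X := Prod.snd) (z₀ := u₀)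
    differentiableAt_snd ((hasFDerivAt_superpose hψ₀ u₀).sub_const (superpose ψ u₀)) (sub_self _)
  simpa [optimalitySystem, residual] using hmoment

/-- On the neighbourhood `U` of `0`, `u (lam, w)` solves the optimality system of `P_lam(y + w)`,
`y = superpose ψ u₀`, starting from `u 0 = u₀`. The set `U` does not depend on the regularity of
`u`, which follows that of `ψ`. -/
structure IsSpikeBranch (ψ : ℝ → H) (s : ι → ℝ) (u₀ : SpikeData ι) (U : Set (ℝ × H))
    (u : ℝ × H → SpikeData ι) : Prop where
  isOpen : IsOpen U
  zero_mem : 0 ∈ U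
  apply_zero : u 0 = u₀
  optimalitySystem_eq_zero : ∀ v ∈ U, optimalitySystem ψ (superpose ψ u₀) s (v, u v) = 0
  contDiffOn : ∀ n : WithTop ℕ∞, n ≠ 0 → ContDiff ℝ (n + 1) ψ → ContDiffOn ℝ n u U

theorem exists_isSpikeBranch [CompleteSpace H] (hψ : ContDiff ℝ 2 ψ) (hu₀ : ∀ i, u₀.1 i ≠ 0)
    (hΓ : Function.Injective (tangentMap ψ u₀.2)) (s : ι → ℝ) :
    ∃ U u, IsSpikeBranch ψ s u₀ U u := by
  have hinv : (fderiv ℝ (optimalitySystem ψ (superpose ψ u₀) s) (0, u₀) ∘L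
      .inr ℝ (ℝ × H) (SpikeData ι)).IsInvertible := by
    rw [fderiv_optimalitySystem_comp_inr hψ]
    exact isInvertible_of_injective
      ((injective_momentMap_comp_tangentMap hΓ).comp (injective_scaleShifts hu₀))
  obtain ⟨U, hU, h0, u, hu, hsol, hreg⟩ :=
    exists_isOpen_implicitFunction (contDiff_optimalitySystem (n := 1) hψ _ s) hinv
  refine ⟨U, u, hU, h0, hu, fun v hv => (hsol v hv).trans ?_, fun n hn hψn =>
    hreg n hn (contDiff_optimalitySystem hψn _ s)⟩
  simp [optimalitySystem, residual]

namespace IsSpikeBranch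

variable {U : Set (ℝ × H)} {u : ℝ × H → SpikeData ι}

theorem mem_nhds (h : IsSpikeBranch ψ s u₀ U u) : U ∈ 𝓝 0 := h.isOpen.mem_nhds h.zero_mem

theorem differentiableAt (h : IsSpikeBranch ψ s u₀ U u) (hψ : ContDiff ℝ 2 ψ) :
    DifferentiableAt ℝ u 0 :=
  ((h.contDiffOn 1 one_ne_zero hψ).contDiffAt h.mem_nhds).differentiableAt one_ne_zero

theorem tendsto (h : IsSpikeBranch ψ s u₀ U u) (hψ : ContDiff ℝ 2 ψ) : Tendsto u (𝓝 0) (𝓝 u₀) :=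
  h.apply_zero ▸ (h.differentiableAt hψ).continuousAt

theorem momentMap_residual (h : IsSpikeBranch ψ s u₀ U u) {v : ℝ × H} (hv : v ∈ U) :
    momentMap ψ (u v).2 (residual ψ (superpose ψ u₀) (v, u v)) = -(v.1 • (s, 0)) :=
  eq_neg_of_add_eq_zero_left (h.optimalitySystem_eq_zero v hv)

theorem hasFDerivAt_residual (h : IsSpikeBranch ψ s u₀ U u) (hψ : ContDiff ℝ 2 ψ) :
    HasFDerivAt (fun v => residual ψ (superpose ψ u₀) (v, u v))
      (tangentMap ψ u₀.2 ∘L scaleShifts u₀.1 ∘L fderiv ℝ u 0 - .snd ℝ ℝ H) 0 := by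
  have hsup := hasFDerivAt_superpose (hψ.differentiable two_ne_zero) u₀
  rw [← h.apply_zero] at hsup
  have hcomp := hsup.comp 0 (h.differentiableAt hψ).hasFDerivAt
  rw [h.apply_zero] at hcomp
  exact hcomp.sub (hasFDerivAt_snd.const_add _)

theorem residual_zero (h : IsSpikeBranch ψ s u₀ U u) :
    residual ψ (superpose ψ u₀) (0, u 0) = 0 := by
  simp [residual, h.apply_zero]

/- `R' v + v.1 • p₀` is orthogonal to the range of `tangentMap`, and lies in it up to `v.2`. -/
theorem norm_fderiv_residual_add_le (h : IsSpikeBranch ψ s u₀ U u) (hψ : ContDiff ℝ 2 ψ)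
    (hp₀ : p₀ ∈ (tangentMap ψ u₀.2).range) (hmoment : momentMap ψ u₀.2 p₀ = (s, 0))
    {R' : ℝ × H →L[ℝ] H} (hR' : HasFDerivAt (fun v => residual ψ (superpose ψ u₀) (v, u v)) R' 0)
    (v : ℝ × H) : ‖R' v + v.1 • p₀‖ ≤ ‖v.2‖ := by
  have hψ₁ : Differentiable ℝ (deriv ψ) :=
    (contDiff_succ_iff_deriv.1 hψ).2.2.differentiable one_ne_zero
  have hlin : momentMap ψ u₀.2 ∘L R' = -(ContinuousLinearMap.fst ℝ ℝ H).smulRight (s, 0) := by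
    have hmomentR := hasFDerivAt_momentMap_apply (hψ.differentiable two_ne_zero) hψ₁
      (h.differentiableAt hψ).snd hR' h.residual_zero
    rw [h.apply_zero] at hmomentR
    refine hmomentR.unique (HasFDerivAt.congr_of_eventuallyEq
      (ContinuousLinearMap.hasFDerivAt _) ?_)
    filter_upwards [h.mem_nhds] with v hv using h.momentMap_residual hv
  refine norm_le_of_mem_orthogonal_of_add_mem (K := (tangentMap ψ u₀.2).range)
    (mem_range_tangentMap_orthogonal.2 ?_) ?_
  · have := congrArg (fun L => L v) hlin
    simp only [ContinuousLinearMap.comp_apply] at this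
    simp [this, hmoment]
  · rw [hR'.unique (h.hasFDerivAt_residual hψ), add_right_comm]
    refine Submodule.add_mem _ ⟨scaleShifts u₀.1 (fderiv ℝ u 0 v), ?_⟩ (Submodule.smul_mem _ _ hp₀)
    simp

theorem eventually_norm_residual_add_le (h : IsSpikeBranch ψ s u₀ U u) (hψ : ContDiff ℝ 2 ψ)
    (hp₀ : p₀ ∈ (tangentMap ψ u₀.2).range) (hmoment : momentMap ψ u₀.2 p₀ = (s, 0)) {ε : ℝ}
    (hε : 0 < ε) :
    ∀ᶠ v in 𝓝 0, ‖residual ψ (superpose ψ u₀) (v, u v) + v.1 • p₀‖ ≤ ‖v.2‖ + ε * ‖v‖ := by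
  have hR' := h.hasFDerivAt_residual hψ
  filter_upwards [hR'.isLittleO.def hε] with v hv
  rw [h.residual_zero, sub_zero, sub_zero] at hv
  set R := residual ψ (superpose ψ u₀) (v, u v)
  set R'v := (tangentMap ψ u₀.2 ∘L scaleShifts u₀.1 ∘L fderiv ℝ u 0 - .snd ℝ ℝ H) v
  calc ‖R + v.1 • p₀‖ = ‖(R'v + v.1 • p₀) + (R - R'v)‖ := by congr 1; abel
    _ ≤ ‖v.2‖ + ε * ‖v‖ := (norm_add_le _ _).trans
      (add_le_add (h.norm_fderiv_residual_add_le hψ hp₀ hmoment hR' v) hv)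

theorem exists_dual_near (h : IsSpikeBranch ψ s u₀ U u) (hψ : ContDiff ℝ 2 ψ)
    (hp₀ : p₀ ∈ (tangentMap ψ u₀.2).range) (hmoment : momentMap ψ u₀.2 p₀ = (s, 0)) {ρ : ℝ}
    (hρ : 0 < ρ) :
    ∃ α > 0, ∀ᶠ v in 𝓝 0, 0 ≤ v.1 → ‖v.2‖ ≤ α * v.1 → ∃ p ∈ Metric.ball p₀ ρ,
      v.1 • p = superpose ψ u₀ + v.2 - superpose ψ (u v) ∧ momentMap ψ (u v).2 p = (s, 0) := by
  refine ⟨min 1 (ρ / 3), by positivity, ?_⟩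
  filter_upwards [h.eventually_norm_residual_add_le hψ hp₀ hmoment (by positivity : 0 < ρ / 3),
    h.mem_nhds] with v hres hvU hlam hw
  rcases hlam.eq_or_lt with hzero | hpos
  · obtain rfl : v = 0 := Prod.ext hzero.symm (norm_le_zero_iff.1 (by simpa [← hzero] using hw))
    exact ⟨p₀, Metric.mem_ball_self hρ, by simp [h.apply_zero], by rwa [h.apply_zero]⟩
  set R := residual ψ (superpose ψ u₀) (v, u v) with hR
  have hnorm : ‖v‖ ≤ v.1 := by
    rw [Prod.norm_def, Real.norm_of_nonneg hlam]
    exact max_le le_rfl (hw.trans (mul_le_of_le_one_left hlam (min_le_left _ _)))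
  refine ⟨-(v.1⁻¹ • R), ?_, ?_, ?_⟩
  · have hdist : -(v.1⁻¹ • R) - p₀ = -(v.1⁻¹ • (R + v.1 • p₀)) := by
      rw [smul_add, inv_smul_smul₀ hpos.ne', neg_add']
    rw [mem_ball_iff_norm, hdist, norm_neg, norm_smul, norm_inv, Real.norm_of_nonneg hlam,
      inv_mul_lt_iff₀ hpos]
    calc ‖R + v.1 • p₀‖ ≤ ‖v.2‖ + ρ / 3 * ‖v‖ := hres
      _ ≤ ρ / 3 * v.1 + ρ / 3 * v.1 := by
        gcongr
        exact hw.trans (by gcongr; exact min_le_right _ _)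
      _ < v.1 * ρ := by linarith [mul_pos hpos hρ]
  · rw [smul_neg, smul_inv_smul₀ hpos.ne', hR, residual, neg_sub]
  · rw [map_neg, map_smul, h.momentMap_residual hvU, smul_neg, neg_neg, inv_smul_smul₀ hpos.ne']

theorem exists_eventually_norm_sub_le (h : IsSpikeBranch ψ s u₀ U u) (hψ : ContDiff ℝ 2 ψ) {α : ℝ}
    (hα : 0 < α) :
    ∃ C, ∀ᶠ v in 𝓝 0, v.1 = ‖v.2‖ / α → ‖u v - u₀‖ ≤ C * ‖v.2‖ := by
  obtain ⟨K, hbound⟩ := (h.differentiableAt hψ).hasFDerivAt.isBigO_sub.bound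
  refine ⟨K * max α⁻¹ 1, ?_⟩
  filter_upwards [hbound] with v hv hlam
  have hnorm : ‖v‖ = max α⁻¹ 1 * ‖v.2‖ := by
    rw [Prod.norm_def, hlam, Real.norm_of_nonneg (by positivity),
      max_mul_of_nonneg _ _ (norm_nonneg _), one_mul, div_eq_inv_mul]
  rwa [sub_zero, h.apply_zero, hnorm, ← mul_assoc] at hv

end IsSpikeBranch

end Branch

section SpikeStability

variable {ι : Type*} [Finite ι]

theorem eventually_injective_comp {Y Z : Type*} [TopologicalSpace Y] [TopologicalSpace Z]
    [T2Space Z] {f : Y → Z} (hf : Continuous f) {X₀ : ι → Y}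
    (hX₀ : Function.Injective fun i => f (X₀ i)) :
    ∀ᶠ X in 𝓝 X₀, Function.Injective fun i => f (X i) := by
  have hne : ∀ᶠ X in 𝓝 X₀, ∀ i j, i ≠ j → f (X i) ≠ f (X j) :=
    eventually_all.2 fun i => eventually_all.2 fun j => by
      by_cases hij : i = j
      · simp [hij]
      · have hpair : Continuous fun X : ι → Y => (f (X i), f (X j)) := by fun_prop
        filter_upwards [hpair.continuousAt.eventually
          (isClosed_diagonal.isOpen_compl.mem_nhds (hX₀.ne hij))] with X hX _ using hX
  filter_upwards [hne] with X hX i j hij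
  exact not_imp_not.1 (hX i j) hij

theorem eventually_sign_eq {a₀ : ι → ℝ} (ha₀ : ∀ i, a₀ i ≠ 0) :
    ∀ᶠ a in 𝓝 a₀, ∀ i, SignType.sign (a i) = SignType.sign (a₀ i) :=
  eventually_all.2 fun i =>
    (continuous_apply i).continuousAt.eventually
      ((continuousAt_sign_of_ne_zero (ha₀ i)).eventually (p := (· = SignType.sign (a₀ i)))
        (by simp [nhds_discrete]))

end SpikeStability

section SourceCondition

variable {φ : C(Torus, ℝ)} {N : ℕ} {a X s : Fin N → ℝ} {p : L2}

theorem exists_lift (x : Fin N → Torus) : ∃ X : Fin N → ℝ, x = fun i => (X i : Torus) := by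
  choose X hX using fun i => QuotientAddGroup.mk_surjective (x i)
  exact ⟨X, funext fun i => (hX i).symm⟩

theorem norm_PhiAdj_le_one_iff :
    ‖PhiAdj φ p‖ ≤ 1 ↔ ∀ t : ℝ, |inner ℝ (feature φ t) p| ≤ 1 := by
  simp only [inner_feature, ContinuousMap.norm_le _ zero_le_one, Real.norm_eq_abs]
  exact QuotientAddGroup.mk_surjective.forall

theorem norm_PhiAdj_le_one_of_interpolates (hs : ∀ i, |s i| = 1)
    (hX : ∀ i, inner ℝ (feature φ (X i)) p = s i)
    (hoff : ∀ t : ℝ, (∀ i, (t : Torus) ≠ X i) → |inner ℝ (feature φ t) p| < 1) :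
    ‖PhiAdj φ p‖ ≤ 1 := by
  refine norm_PhiAdj_le_one_iff.2 fun t => ?_
  by_cases ht : ∀ i, (t : Torus) ≠ X i
  · exact (hoff t ht).le
  · push Not at ht
    obtain ⟨i, hi⟩ := ht
    rw [inner_feature, hi, ← inner_feature, hX, hs]

theorem norm_le_apply_of_isDualSolution {m : Radon} (hm : ∃ q, PhiAdj φ q ∈ subdiffTV m)
    (hp : IsDualSolution φ (Phi φ m) p) : ‖m‖ ≤ m (PhiAdj φ p) := by
  obtain ⟨q, hq⟩ := hm
  have hqp := hp.2 q (norm_le_one_of_mem_subdiffTV hq)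
  rw [inner_Phi, inner_Phi] at hqp
  exact (norm_le_apply_of_mem_subdiffTV hq).trans hqp

theorem PhiAdj_eq_sign_of_isDualSolution {x : Fin N → Torus} (ha : ∀ i, a i ≠ 0)
    (hx : Function.Injective x) (hm : ∃ q, PhiAdj φ q ∈ subdiffTV (discreteMeasure a x))
    (hp : IsDualSolution φ (Phi φ (discreteMeasure a x)) p) (i : Fin N) :
    PhiAdj φ p (x i) = SignType.sign (a i) := by
  have hle : ∀ j ∈ Finset.univ, a j * PhiAdj φ p (x j) ≤ |a j| := fun j _ => by
    refine (le_abs_self _).trans ?_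
    rw [abs_mul]
    exact mul_le_of_le_one_right (abs_nonneg _)
      (((PhiAdj φ p).norm_coe_le_norm (x j)).trans hp.1)
  have hsum : ∑ j, |a j| ≤ ∑ j, a j * PhiAdj φ p (x j) := by
    rw [← norm_sum_smul_evalCLM a hx, ← discreteMeasure_apply]
    exact norm_le_apply_of_isDualSolution hm hp
  have heq : a i * PhiAdj φ p (x i) = |a i| := (Finset.sum_eq_sum_iff_of_le hle).1
    ((Finset.sum_le_sum hle).antisymm hsum) i (Finset.mem_univ i)
  rw [← self_mul_sign] at heq
  exact mul_left_cancel₀ (ha i) heq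

theorem isNondegenerateCertificate_of_norm_PhiAdj_le_one (hφ : IsC 2 φ) (hs : ∀ i, |s i| = 1)
    (hp : ‖PhiAdj φ p‖ ≤ 1) (hX : ∀ i, PhiAdj φ p (X i : Torus) = s i)
    (hoff : ∀ t, t ∉ Set.range (fun i => (X i : Torus)) → |PhiAdj φ p t| < 1)
    (hnd : ∀ i, torusDeriv (torusDeriv (PhiAdj φ p)) (X i : Torus) ≠ 0) :
    IsNondegenerateCertificate 1 (feature φ) X s p := by
  have hψ : ContDiff ℝ 2 (feature φ) := contDiff_feature (n := 2) hφ
  have hψ₀ : Differentiable ℝ (feature φ) := hψ.differentiable two_ne_zero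
  have hψ₁ : Differentiable ℝ (deriv (feature φ)) :=
    (contDiff_succ_iff_deriv.1 hψ).2.2.differentiable one_ne_zero
  set η : ℝ → ℝ := fun t => inner ℝ (feature φ t) p
  have hηX : ∀ i, η (X i) = s i := fun i => (inner_feature p (X i)).trans (hX i)
  have habs : ∀ i, |η (X i)| = 1 := fun i => by rw [hηX, hs]
  have hη_le : ∀ t, |η t| ≤ 1 := norm_PhiAdj_le_one_iff.1 hp
  have hη' : deriv η = fun t => inner ℝ (deriv (feature φ) t) p := deriv_inner_const hψ₀ p
  have hη'' : deriv (deriv η) = fun t => inner ℝ (deriv (deriv (feature φ)) t) p :=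
    hη' ▸ deriv_inner_const hψ₁ p
  refine ⟨hs, hηX, fun i => ?_, fun i => ?_, fun t ht => ?_⟩
  · exact (congrFun hη' (X i)).symm.trans (deriv_eq_zero_of_abs_le_one hη_le (habs i))
  · have hle : η (X i) * deriv (deriv η) (X i) ≤ 0 := mul_deriv_deriv_nonpos_of_abs_le_one
      ((hψ₀ (X i)).continuousAt.inner continuousAt_const) hη_le (habs i)
    rw [hη'', hηX] at hle
    refine hle.lt_of_ne (mul_ne_zero (abs_pos.1 (hs i ▸ one_pos)) ?_)
    exact (torusDeriv_torusDeriv_PhiAdj hφ p (X i)).symm.trans_ne (hnd i)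
  · rw [inner_feature]
    exact hoff _ fun ⟨i, hi⟩ => ht i hi.symm

/- Perturbations of `p` orthogonal to the range of `tangentMap` still interpolate the signs with
vanishing derivatives, so small ones remain dual solutions and cannot have a smaller norm. -/
theorem mem_range_tangentMap_of_isMinNormDualSolution (hφ : IsC 2 φ)
    (hp : IsMinNormDualSolution φ (Phi φ (discreteMeasure a fun i => (X i : Torus))) p)
    (hcert : IsNondegenerateCertificate 1 (feature φ) X s p) :
    p ∈ (tangentMap (feature φ) X).range := by
  have hcont : Continuous fun q : L2 => (X, q) := by fun_prop
  refine mem_of_eventually_norm_le ?_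
  filter_upwards [(hcont.tendsto p).eventually (hcert.eventually_abs_inner_lt_one
    (contDiff_feature (n := 2) hφ) periodic_feature)] with q hq hqK
  have hmoment : momentMap (feature φ) X q = (s, 0) := by
    rw [← hcert.momentMap_eq, ← sub_eq_zero, ← map_sub]
    exact mem_range_tangentMap_orthogonal.1 hqK
  rw [momentMap_apply, Prod.mk.injEq] at hmoment
  have hqX := congrFun hmoment.1
  refine hp.2 q ⟨norm_PhiAdj_le_one_of_interpolates hcert.abs_sign hqX
    (hq hqX (congrFun hmoment.2)), fun q' hq' => (hp.1.2 q' hq').trans_eq ?_⟩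
  simp only [Phi_discreteMeasure, sum_inner, inner_smul_left, hcert.inner_eq, hqX]

theorem NDSC.exists_isNondegenerateCertificate (hφ : IsC 2 φ) (ha : ∀ i, a i ≠ 0)
    (hX : Function.Injective fun i => (X i : Torus)) (h : NDSC φ a fun i => (X i : Torus)) :
    ∃ p ∈ (tangentMap (feature φ) X).range,
      IsNondegenerateCertificate 1 (feature φ) X (fun i => SignType.sign (a i)) p := by
  obtain ⟨hsource, p, hp, hoff, hnd⟩ := h
  have hcert := isNondegenerateCertificate_of_norm_PhiAdj_le_one hφ
    (fun i => by rcases (ha i).lt_or_gt with hi | hi <;> simp [hi]) hp.1.1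
    (PhiAdj_eq_sign_of_isDualSolution ha hX hsource hp.1) hoff hnd
  exact ⟨p, mem_range_tangentMap_of_isMinNormDualSolution hφ hp hcert, hcert⟩

theorem injective_tangentMap_feature (hφ : IsC 2 φ)
    (hΓ : Function.Injective (Gam φ hφ fun i => (X i : Torus))) :
    Function.Injective (tangentMap (feature φ) X) := by
  convert hΓ using 1
  funext q
  rw [tangentMap_apply, Gam_coe, Finset.sum_add_distrib]

theorem injective_Phi_discreteMeasure (hX : LinearIndependent ℝ fun i => feature φ (X i)) :
    Function.Injective fun b => Phi φ (discreteMeasure b fun i => (X i : Torus)) := by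
  simp only [Phi_discreteMeasure]
  exact linearIndependent_iff_injective_fintypeLinearCombination.1 hX

end SourceCondition

section SmallNoise

variable {α lam0 : ℝ}

theorem norm_le_of_mem_smallNoise {v : ℝ × L2} (hv : v ∈ smallNoise α lam0) :
    ‖v‖ ≤ max 1 α * v.1 := by
  obtain ⟨hlam, -, hw⟩ := hv
  rw [Prod.norm_def, Real.norm_of_nonneg hlam]
  exact max_le (le_mul_of_one_le_left hlam (le_max_left _ _))
    (hw.trans (mul_le_mul_of_nonneg_right (le_max_right _ _) hlam))

theorem norm_div_mem_smallNoise (hα : 0 < α) {w : L2} (hw : ‖w‖ / α ≤ lam0) :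
    (‖w‖ / α, w) ∈ smallNoise α lam0 :=
  ⟨by positivity, hw, (mul_div_cancel₀ _ hα.ne').ge⟩

theorem exists_forall_mem_smallNoise (α : ℝ) {P : ℝ × L2 → Prop} (hP : ∀ᶠ v in 𝓝 0, P v) :
    ∃ lam0 > 0, ∀ v ∈ smallNoise α lam0, P v := by
  obtain ⟨δ, hδ, hball⟩ := Metric.eventually_nhds_iff_ball.1 hP
  have hmax : 0 < max 1 α := one_pos.trans_le (le_max_left _ _)
  refine ⟨δ / 2 / max 1 α, by positivity, fun v hv => hball v (mem_ball_zero_iff.2 ?_)⟩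
  calc ‖v‖ ≤ max 1 α * v.1 := norm_le_of_mem_smallNoise hv
    _ ≤ max 1 α * (δ / 2 / max 1 α) := by gcongr; exact hv.2.1
    _ < δ := by rw [mul_div_cancel₀ _ hmax.ne']; exact half_lt_self hδ

end SmallNoise

namespace IsSpikeBranch

variable {φ : C(Torus, ℝ)} {N : ℕ} {s : Fin N → ℝ} {u₀ : SpikeData (Fin N)} {U : Set (ℝ × L2)}
  {u : ℝ × L2 → SpikeData (Fin N)}

theorem exists_eventually_primalSolutions_eq {a₀ X₀ : Fin N → ℝ} {p₀ : L2} (hφ : IsC 2 φ)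
    (h : IsSpikeBranch (feature φ) (fun i => SignType.sign (a₀ i)) (a₀, X₀) U u)
    (ha₀ : ∀ i, a₀ i ≠ 0) (hΓ : Function.Injective (tangentMap (feature φ) X₀))
    (hp₀ : p₀ ∈ (tangentMap (feature φ) X₀).range)
    (hcert : IsNondegenerateCertificate 1 (feature φ) X₀ (fun i => SignType.sign (a₀ i)) p₀) :
    ∃ α > 0, ∀ᶠ v in 𝓝 0, 0 ≤ v.1 → ‖v.2‖ ≤ α * v.1 →
      {m | IsPrimalSolution φ v.1 (Phi φ (discreteMeasure a₀ fun i => (X₀ i : Torus)) + v.2) m} =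
        {discreteMeasure (u v).1 fun i => ((u v).2 i : Torus)} := by
  have hψ : ContDiff ℝ 2 (feature φ) := contDiff_feature (n := 2) hφ
  obtain ⟨ρ, hρ, hcert_near⟩ := Metric.eventually_nhds_iff_ball.1
    (hcert.eventually_abs_inner_lt_one hψ periodic_feature)
  obtain ⟨α, hα, hdual⟩ := h.exists_dual_near hψ hp₀ hcert.momentMap_eq hρ
  have hX : Tendsto (fun v => (u v).2) (𝓝 0) (𝓝 X₀) := (h.tendsto hψ).snd_nhds
  have hli : ∀ᶠ X in 𝓝 X₀, LinearIndependent ℝ fun i => feature φ (X i) :=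
    (show Continuous fun X : Fin N → ℝ => fun i => feature φ (X i) from
      continuous_pi fun i => hψ.continuous.comp (continuous_apply i)).continuousAt.eventually
        (linearIndependent_of_injective_tangentMap hΓ).eventually
  refine ⟨α, hα, ?_⟩
  filter_upwards [hdual, hX.eventually (Metric.ball_mem_nhds X₀ hρ), hX.eventually hli,
    (h.tendsto hψ).fst_nhds.eventually (eventually_sign_eq ha₀)] with v hv hXv hliv hsign hlam hw
  obtain ⟨p, hp, hres, hmoment⟩ := hv hlam hw
  rw [momentMap_apply, Prod.mk.injEq] at hmoment
  have hpX := congrFun hmoment.1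
  have hoff := hcert_near ((u v).2, p) (ball_prod_same X₀ p₀ ρ ▸ ⟨hXv, hp⟩) hpX
    (congrFun hmoment.2)
  refine primalSolutions_eq_singleton_discreteMeasure (p := p) hlam ?_
    (norm_PhiAdj_le_one_of_interpolates hcert.abs_sign hpX hoff) (fun t ht => ?_) (fun i => ?_)
    (injective_Phi_discreteMeasure hliv)
  · rw [Phi_discreteMeasure, Phi_discreteMeasure]
    exact hres
  · obtain ⟨t, rfl⟩ := QuotientAddGroup.mk_surjective t
    exact (inner_feature p t ▸ hoff t) fun i hi => ht ⟨i, hi.symm⟩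
  · rw [← inner_feature, hpX, ← hsign, self_mul_sign]

theorem contDiffOn_of_isC (h : IsSpikeBranch (feature φ) s u₀ U u) {k : ℕ} (hk : 2 ≤ k)
    (hφ : IsC k φ) :
    ContDiffOn ℝ (k - 1 : ℕ) (fun v => (u v).1) U ∧
      TorusContDiffOn (k - 1 : ℕ) (fun v i => ((u v).2 i : Torus)) U := by
  obtain ⟨j, rfl⟩ : ∃ j, k = j + 1 := ⟨k - 1, by lia⟩
  have hu : ContDiffOn ℝ j u U :=
    h.contDiffOn j (by norm_cast; lia) (by exact_mod_cast contDiff_feature hφ)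
  exact ⟨hu.fst, fun v hv => ⟨fun v => (u v).2, hu.snd v hv, Eventually.of_forall fun _ _ => rfl⟩⟩

end IsSpikeBranch

theorem norm_spike_sub_le {ι : Type*} [Fintype ι] {T : ℝ} (u u₀ : SpikeData ι) (i : ι) :
    ‖(u.2 i : AddCircle T) - u₀.2 i‖ ≤ ‖u - u₀‖ ∧ |u.1 i - u₀.1 i| ≤ ‖u - u₀‖ := by
  constructor
  · calc ‖(u.2 i : AddCircle T) - u₀.2 i‖ ≤ ‖u.2 i - u₀.2 i‖ := QuotientAddGroup.norm_mk_le_norm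
      _ ≤ ‖u - u₀‖ := (norm_le_pi_norm (u - u₀).2 i).trans (norm_snd_le _)
  · exact (norm_le_pi_norm (u - u₀).1 i).trans (norm_fst_le _)

end SpikeDeconv

end

theorem mainTheorem1 (φ : C(Torus, ℝ)) (hφ : IsC 2 φ) {N : ℕ}
    (a₀ : Fin N → ℝ) (x₀ : Fin N → Torus)
    (ha₀ : ∀ i, a₀ i ≠ 0) (hx₀ : Function.Injective x₀)
    (hΓ : Function.Injective (Gam φ hφ x₀))
    (hN : NDSC φ a₀ x₀) :
    ∃ α > 0, ∃ lam0 > 0, ∃ (a : ℝ × L2 → Fin N → ℝ) (x : ℝ × L2 → Fin N → Torus),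
      -- the solution is unique and has exactly `N` spikes, with the signs of `a₀`
      (∀ lam : ℝ, ∀ w : L2, (lam, w) ∈ smallNoise α lam0 →
        {m : Radon | IsPrimalSolution φ lam (Phi φ (discreteMeasure a₀ x₀) + w) m} =
            {discreteMeasure (a (lam, w)) (x (lam, w))} ∧
          Function.Injective (x (lam, w)) ∧
          ∀ i, a (lam, w) i ≠ 0 ∧ SignType.sign (a (lam, w) i) = SignType.sign (a₀ i)) ∧
      a (0, 0) = a₀ ∧ x (0, 0) = x₀ ∧
      -- amplitudes and positions are `C^{k-1}`, up to the boundary of the domain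
      (∃ U : Set (ℝ × L2), IsOpen U ∧ smallNoise α lam0 ⊆ U ∧
        ∀ k : ℕ, 2 ≤ k → IsC k φ →
          ContDiffOn ℝ (k - 1 : ℕ) a U ∧ TorusContDiffOn (k - 1 : ℕ) x U) ∧
      -- linear convergence for `lam = ‖w‖ / α`
      ∃ C : ℝ, ∀ w : L2, ‖w‖ / α ≤ lam0 → ∀ i,
        ‖x (‖w‖ / α, w) i - x₀ i‖ ≤ C * ‖w‖ ∧ |a (‖w‖ / α, w) i - a₀ i| ≤ C * ‖w‖ := by
  obtain ⟨X₀, rfl⟩ := exists_lift x₀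
  obtain ⟨p₀, hp₀, hcert⟩ := hN.exists_isNondegenerateCertificate hφ ha₀ hx₀
  have hψ : ContDiff ℝ 2 (feature φ) := contDiff_feature (n := 2) hφ
  have hΓ' := injective_tangentMap_feature hφ hΓ
  obtain ⟨U, u, hu⟩ := exists_isSpikeBranch (u₀ := (a₀, X₀)) hψ ha₀ hΓ'
    fun i => SignType.sign (a₀ i)
  have hu₀ : u (0, 0) = (a₀, X₀) := hu.apply_zero
  obtain ⟨α, hα, hsol⟩ := hu.exists_eventually_primalSolutions_eq hφ ha₀ hΓ' hp₀ hcert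
  obtain ⟨C, hrate⟩ := hu.exists_eventually_norm_sub_le hψ hα
  have hspikes := (hu.tendsto hψ).eventually ((eventually_sign_eq ha₀).prod_nhds
    (eventually_injective_comp (AddCircle.continuous_mk' 1) hx₀))
  obtain ⟨lam0, hlam0, hall⟩ := exists_forall_mem_smallNoise α
    (hsol.and (hspikes.and (hrate.and (eventually_mem_set.2 hu.mem_nhds))))
  refine ⟨α, hα, lam0, hlam0, fun v => (u v).1, fun v i => ((u v).2 i : Torus), ?_, ?_, ?_,
    ⟨U, hu.isOpen, fun v hv => (hall v hv).2.2.2, fun k => hu.contDiffOn_of_isC⟩,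
    C, fun w hw i => ?_⟩
  · intro lam w hv
    obtain ⟨hunique, ⟨hsign, hinj⟩, -⟩ := hall _ hv
    exact ⟨hunique hv.1 hv.2.2, hinj, fun i =>
      ⟨sign_ne_zero.1 (hsign i ▸ sign_ne_zero.2 (ha₀ i)), hsign i⟩⟩
  · simp only [hu₀]
  · simp only [hu₀]
  · have hle := (hall _ (norm_div_mem_smallNoise hα hw)).2.2.1 rfl
    have hi := norm_spike_sub_le (T := 1) (u (‖w‖ / α, w)) (a₀, X₀) i
    exact ⟨hi.1.trans hle, hi.2.trans hle⟩
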